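/- Let $k$ be a field of characteristic $0$, let $n\ge 0$, and let $R$ be either the formal power series ring $k[[x_1,\dots,x_n]]$ or the polynomial ring $k[x_1,\dots,x_n]$. Let $I$ be an ideal of $R$ and $i\ge 0$ an integer, and let $H^i_I(R)=\varinjlim_t \operatorname{Ext}^i_R(R/I^t,R)$ be the $i$-th local cohomology module of $R$ with support in $I$. If $H^i_I(R)\neq 0$, then $$\operatorname{Ann}_R\bigl(\operatorname{Hom}_R(H^i_I(R),H^i_I(R))\bigr)=0 .$$ -/

import Mathlib

/-- The `i`-th local cohomology module `H^i_I(R)` of the ring `R` with support in the ideal `I`,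
that is, the direct limit over `t` of the `R`-modules `Ext^i_R(R / I ^ t, R)`. -/
noncomputable abbrev ringLocalCohomology {R : Type*} [CommRing R] (I : Ideal R) (i : ℕ) :
    ModuleCat R :=
  (localCohomology I i).obj (ModuleCat.of R R)

open CategoryTheory Limits

universe u v

/-! ### Homology classes under twisted Leibniz maps -/

section Homology

variable {R : Type u} [CommRing R]

/-! If `M = H^i_I(R)` carried an action of a derivation `δ`, then `δ(r • m) = δ r • m + r • δ m`
would show that `r ∈ Ann M` forces `δ r ∈ Ann M`. No such action is built: the identity is proved at
finite level, where `δ` maps `R ⧸ I ^ (t + 1)` to `R ⧸ I ^ t`, lifts to projective resolutions, and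
gives `Ext_smul_map_eq_smul_of_smul_eq_zero`. Encoding a derivation as a linear map into
`TwistedProd` makes the usual comparison of resolutions apply. So `Ann M`, which equals `Ann Hom(M,
M)`, is stable under all partial derivatives; in characteristic zero such an ideal is `0` or the
whole ring, and the latter means `M = 0`. -/

/-- If additive maps `D j` commute with the differentials and satisfy a twisted Leibniz rule with
respect to a chain map `α`, then a class killed by `r` is sent by `s • α` into the multiples of `r`. -/
lemma HomologicalComplex.smul_homologyMap_eq_smul_of_smul_eq_zero {ι : Type*}
    {c : ComplexShape ι} {K L : HomologicalComplex (ModuleCat.{v} R) c}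
    (α : K ⟶ L) (D : ∀ j, K.X j →+ L.X j)
    (hD : ∀ i j x, D j (K.d i j x) = L.d i j (D i x)) (r s : R)
    (hrs : ∀ j x, D j (r • x) = r • D j x - s • α.f j x)
    (i : ι) (ξ : K.homology i) (hξ : r • ξ = 0) :
    ∃ η : L.homology i, s • HomologicalComplex.homologyMap α i ξ = r • η := by
  obtain ⟨z, rfl⟩ := (ModuleCat.epi_iff_surjective (K.homologyπ i)).1 inferInstance ξ
  have hex : (ShortComplex.mk (K.toCycles (c.prev i) i) (K.homologyπ i) (by simp)).Exact :=
    ShortComplex.exact_of_g_is_cokernel _ (K.homologyIsCokernel _ i rfl)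
  obtain ⟨y, hy⟩ := (ShortComplex.moduleCat_exact_iff _).1 hex (r • z) (by simpa using hξ)
  have hy' : K.d (c.prev i) i y = r • K.iCycles i z := by
    rw [← map_smul, ← hy]
    simp [← ModuleCat.comp_apply]
  have hz : L.d i (c.next i) (D i (K.iCycles i z)) = 0 := by
    rw [← hD, ← ModuleCat.comp_apply]
    simp
  have hex' : (ShortComplex.mk (L.iCycles i) (L.d i (c.next i)) (by simp)).Exact :=
    ShortComplex.exact_of_f_is_kernel _ (L.cyclesIsKernel i _ rfl)
  obtain ⟨w, hw⟩ := (ShortComplex.moduleCat_exact_iff _).1 hex' _ hz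
  change L.iCycles i w = _ at hw
  refine ⟨L.homologyπ i w, ?_⟩
  -- Apply `D` to `d y = r • z`: the left side becomes the boundary of `D y`, the right side `r • D
  -- z - s • α z`.
  have key : s • HomologicalComplex.cyclesMap α i z + L.toCycles (c.prev i) i (D _ y) = r • w := by
    apply (ModuleCat.mono_iff_injective (L.iCycles i)).1 inferInstance
    rw [map_add, map_smul, map_smul, hw, ← ModuleCat.comp_apply, ← ModuleCat.comp_apply,
      HomologicalComplex.toCycles_i, HomologicalComplex.cyclesMap_i, ← hD, hy', hrs,
      ModuleCat.comp_apply]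
    abel
  rw [← map_smul (L.homologyπ i).hom, ← key, map_add, map_smul, ← ModuleCat.comp_apply,
    ← ModuleCat.comp_apply (L.toCycles _ i), HomologicalComplex.homologyπ_naturality,
    L.toCycles_comp_homologyπ]
  simp

end Homology

/-! ### Derivations as linear maps into a twisted product -/

section Twist

variable {R : Type u} [CommRing R] (δ : Derivation ℤ R R)

/-- The product `M × M` with the `R`-module structure `r • (a, b) = (r • a, r • b + δ r • a)`. -/
def TwistedProd (_δ : Derivation ℤ R R) (M : Type v) : Type v := M × M

namespace TwistedProd

section

variable {δ} {M : Type v}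

/-- The pair `(a, b)` as an element of the twisted product. -/
def mk (δ : Derivation ℤ R R) (a b : M) : TwistedProd δ M := (a, b)

@[ext] lemma ext {x y : TwistedProd δ M} (h₁ : x.1 = y.1) (h₂ : x.2 = y.2) : x = y :=
  Prod.ext h₁ h₂

@[simp] lemma mk_fst (a b : M) : (mk δ a b).1 = a := rfl
@[simp] lemma mk_snd (a b : M) : (mk δ a b).2 = b := rfl

end

section

variable {δ} {M : Type v} [AddCommGroup M]

instance : AddCommGroup (TwistedProd δ M) := inferInstanceAs (AddCommGroup (M × M))

@[simp] lemma add_fst (x y : TwistedProd δ M) : (x + y).1 = x.1 + y.1 := rfl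
@[simp] lemma add_snd (x y : TwistedProd δ M) : (x + y).2 = x.2 + y.2 := rfl
@[simp] lemma zero_fst : (0 : TwistedProd δ M).1 = 0 := rfl
@[simp] lemma zero_snd : (0 : TwistedProd δ M).2 = 0 := rfl

end

variable {δ} {M : Type v} [AddCommGroup M] [Module R M]

instance : SMul R (TwistedProd δ M) := ⟨fun r x => mk δ (r • x.1) (r • x.2 + δ r • x.1)⟩

@[simp] lemma smul_fst (r : R) (x : TwistedProd δ M) : (r • x).1 = r • x.1 := rfl
@[simp] lemma smul_snd (r : R) (x : TwistedProd δ M) : (r • x).2 = r • x.2 + δ r • x.1 := rfl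

instance : Module R (TwistedProd δ M) where
  one_smul x := by ext <;> simp
  mul_smul r s x := by ext <;> simp [mul_smul, add_smul, smul_comm s (δ r)]; abel
  smul_zero r := by ext <;> simp
  smul_add r x y := by ext <;> simp; abel
  add_smul r s x := by ext <;> simp [add_smul]; abel
  zero_smul x := by ext <;> simp

variable (δ M) in
/-- The first projection. -/
@[simps] def fst : TwistedProd δ M →ₗ[R] M where
  toFun x := x.1
  map_add' _ _ := rfl
  map_smul' _ _ := rfl

variable {N : Type v} [AddCommGroup N] [Module R N]

variable (δ) in
/-- The map induced by a linear map on both components. -/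
@[simps] def map (f : M →ₗ[R] N) : TwistedProd δ M →ₗ[R] TwistedProd δ N where
  toFun x := mk δ (f x.1) (f x.2)
  map_add' x y := by ext <;> simp
  map_smul' r x := by ext <;> simp

variable (δ) in
/-- The linear retraction `(a, b) ↦ b - δ a` of the twisted product of `R`. -/
@[simps] def untwist : TwistedProd δ R →ₗ[R] R where
  toFun x := x.2 - δ x.1
  map_add' x y := by simp; abel
  map_smul' r x := by simp; ring

lemma projective [Module.Projective R M] : Module.Projective R (TwistedProd δ M) := by
  -- The kernel of `fst` is `M` with its usual action, so a section of `fst` splits the twisted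
  -- product as `M × M`.
  obtain ⟨s, hs⟩ := Module.projective_lifting_property (fst δ M) LinearMap.id
    (fun m => ⟨mk δ m 0, rfl⟩)
  have hs' (m : M) : (s m).1 = m := LinearMap.congr_fun hs m
  let e : (M × M) ≃ₗ[R] TwistedProd δ M :=
    { toFun := fun p => s p.1 + mk δ 0 p.2
      invFun := fun x => (x.1, x.2 - (s x.1).2)
      map_add' := fun p q => by ext <;> simp; abel
      map_smul' := fun r p => by ext <;> simp [add_comm]
      left_inv := fun p => by ext <;> simp [hs']
      right_inv := fun x => by ext <;> simp [hs'] }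
  exact Module.Projective.of_equiv e

end TwistedProd

/-- The twisted product as an endofunctor of the category of modules. -/
def twistFunctor : ModuleCat.{v} R ⥤ ModuleCat.{v} R where
  obj M := ModuleCat.of R (TwistedProd δ M)
  map f := ModuleCat.ofHom (TwistedProd.map δ f.hom)

instance : (twistFunctor.{u, v} δ).Additive where
  map_add {X Y f g} := by
    ext x
    rfl

instance : (twistFunctor.{u, v} δ).PreservesHomology :=
  Functor.preservesHomology_of_map_exact _ fun S hS => by
    rw [ShortComplex.moduleCat_exact_iff] at hS ⊢
    intro x hx
    obtain ⟨a, ha⟩ := hS _ (congrArg Prod.fst hx)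
    obtain ⟨b, hb⟩ := hS _ (congrArg Prod.snd hx)
    exact ⟨TwistedProd.mk (M := S.X₁) δ a b, TwistedProd.ext (δ := δ) (M := S.X₂) ha hb⟩

instance : (twistFunctor.{u, max u v} δ).PreservesProjectiveObjects where
  projective_obj {P} hP := by
    rw [← IsProjective.iff_projective] at hP
    exact (IsProjective.iff_projective _).1 (TwistedProd.projective (δ := δ) (M := P))

/-- The first projection as a natural transformation. -/
def twistFst : twistFunctor.{u, v} δ ⟶ 𝟭 _ where
  app M := ModuleCat.ofHom (TwistedProd.fst δ M)

end Twist

/-! ### Functoriality of Ext on chosen resolutions -/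

section ExtNaturality

variable {R : Type u} [CommRing R]

lemma inv_comp_comp_eq_of_comm {C : Type*} [Category* C] {a a' b b' x x' : C}
    (e : a ≅ b) (e' : a' ≅ b') {m : a ⟶ a'} {n : b ⟶ b'} (h : m ≫ e'.hom = e.hom ≫ n)
    {p : a ⟶ x} {p' : a' ⟶ x'} {l : x ⟶ x'} (h' : p ≫ l = m ≫ p') :
    e.inv ≫ p ≫ l = n ≫ e'.inv ≫ p' := by
  rw [h', Iso.inv_comp_eq, ← reassoc_of% h, Iso.hom_inv_id_assoc]

/-- The morphism `Hom(Y, N) ⟶ Hom(X, N)` of cochain complexes induced by a chain map `X ⟶ Y`. -/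
noncomputable def ChainComplex.linearYonedaMap {X Y : ChainComplex (ModuleCat.{v} R) ℕ}
    (h : X ⟶ Y) (N : ModuleCat.{v} R) :
    Y.linearYonedaObj R N ⟶ X.linearYonedaObj R N where
  f j := ((linearYoneda R (ModuleCat.{v} R)).obj N).map (h.f j).op
  comm' i j _ := by
    ext x
    exact congrArg (· ≫ (x : Y.X i ⟶ N)) (h.comm j i).symm

lemma Ext_map_comp_isoExt_hom {A B : ModuleCat.{u} R} (π : A ⟶ B) (P : ProjectiveResolution A)
    (Q : ProjectiveResolution B) (h : P.complex ⟶ Q.complex)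
    (comm : h.f 0 ≫ Q.π.f 0 = P.π.f 0 ≫ π) (i : ℕ) (N : ModuleCat.{u} R) :
    ((Ext R (ModuleCat.{u} R) i).map π.op).app N ≫ (P.isoExt i N).hom =
      (Q.isoExt i N).hom ≫
        HomologicalComplex.homologyMap (ChainComplex.linearYonedaMap h N) i := by
  have h₁ := ProjectiveResolution.isoLeftDerivedObj_inv_naturality π P Q h comm
    ((linearYoneda R (ModuleCat.{u} R)).obj N).rightOp i
  have h₂ := HomologicalComplex.homologyOp_hom_naturality (ChainComplex.linearYonedaMap h N) i
  exact congrArg Quiver.Hom.unop (inv_comp_comp_eq_of_comm _ _ h₂ h₁)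

end ExtNaturality

/-! ### Derivations acting on Ext -/

section ExtTwist

variable {R : Type u} [CommRing R] {δ : Derivation ℤ R R}

/-- `TwistedProd.untwist` as a morphism in the category of modules. -/
def untwistHom (δ : Derivation ℤ R R) :
    (twistFunctor δ).obj (ModuleCat.of R R) ⟶ ModuleCat.of R R :=
  ModuleCat.ofHom (TwistedProd.untwist δ)

/-- A linear map `g = (π, D) : X ⟶ Y × Y` into the twisted product makes `D` a derivation over `π`;
this is the map `φ ↦ φ ∘ D - δ ∘ φ ∘ π` on linear forms. -/
def nablaHom {X Y : ModuleCat.{u} R} (g : X ⟶ (twistFunctor δ).obj Y) :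
    (Y ⟶ ModuleCat.of R R) →+ (X ⟶ ModuleCat.of R R) :=
  AddMonoidHom.mk'
    (fun φ => g ≫ (twistFunctor δ).map φ ≫ untwistHom δ) fun φ ψ => by
      rw [Functor.map_add, Preadditive.add_comp, Preadditive.comp_add]

lemma nablaHom_smul {X Y : ModuleCat.{u} R} (g : X ⟶ (twistFunctor δ).obj Y) (r : R)
    (φ : Y ⟶ ModuleCat.of R R) :
    nablaHom g (r • φ) = r • nablaHom g φ - δ r • ((g ≫ (twistFst δ).app Y) ≫ φ) := by
  ext x
  generalize hy : (show TwistedProd δ Y from g x) = y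
  have h₁ : nablaHom g (r • φ) x = r * φ y.2 - δ (r * φ y.1) := by rw [← hy]; rfl
  have h₂ : nablaHom g φ x = φ y.2 - δ (φ y.1) := by rw [← hy]; rfl
  have h₃ : ((g ≫ (twistFst δ).app Y) ≫ φ) x = φ y.1 := by rw [← hy]; rfl
  change nablaHom g (r • φ) x = r * nablaHom g φ x - δ r * ((g ≫ (twistFst δ).app Y) ≫ φ) x
  rw [h₁, h₂, h₃, δ.leibniz, smul_eq_mul, smul_eq_mul]
  ring

lemma nablaHom_comp_left {X X' Y : ModuleCat.{u} R} (e : X' ⟶ X)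
    (g : X ⟶ (twistFunctor δ).obj Y) (φ : Y ⟶ ModuleCat.of R R) :
    nablaHom (e ≫ g) φ = e ≫ nablaHom g φ :=
  Category.assoc e g ((twistFunctor δ).map φ ≫ untwistHom δ)

lemma nablaHom_comp_map {X Y Y' : ModuleCat.{u} R}
    (g : X ⟶ (twistFunctor δ).obj Y) (d : Y ⟶ Y') (φ : Y' ⟶ ModuleCat.of R R) :
    nablaHom (g ≫ (twistFunctor δ).map d) φ = nablaHom g (d ≫ φ) := by
  change (g ≫ _) ≫ _ ≫ untwistHom δ = g ≫ _ ≫ untwistHom δ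
  rw [Functor.map_comp, Category.assoc, Category.assoc]

/-- The twist is exact and preserves projectives, so it carries `Q` to a resolution of the twisted
`B`, to which `f` lifts. -/
lemma CategoryTheory.ProjectiveResolution.exists_lift_twist {A B : ModuleCat.{u} R}
    (f : A ⟶ (twistFunctor δ).obj B) (P : ProjectiveResolution A) (Q : ProjectiveResolution B) :
    ∃ g : ∀ j, P.complex.X j ⟶ (twistFunctor δ).obj (Q.complex.X j),
      (∀ i j, g i ≫ (twistFunctor δ).map (Q.complex.d i j) = P.complex.d i j ≫ g j) ∧
      g 0 ≫ (twistFunctor δ).map (show Q.complex.X 0 ⟶ B from Q.π.f 0) =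
        (show P.complex.X 0 ⟶ A from P.π.f 0) ≫ f := by
  let Q' := (twistFunctor δ).mapProjectiveResolution Q
  refine ⟨fun j => (lift f P Q').f j, fun i j => (lift f P Q').comm i j,
    Eq.trans ?_ (lift_commutes_zero f P Q')⟩
  refine congrArg ((lift f P Q').f 0 ≫ ·) ?_
  change _ = (((twistFunctor δ).mapHomologicalComplex _).map Q.π).f 0 ≫
    ((HomologicalComplex.singleMapHomologicalComplex (twistFunctor δ)
      (ComplexShape.down ℕ) 0).hom.app B).f 0
  rw [HomologicalComplex.singleMapHomologicalComplex_hom_app_self]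
  simp
  rfl

/-- If `r` kills a class `ξ` in `Ext^i(B, R)` and `π : A ⟶ B` admits a `δ`-derivation `A → B` over
it, then `δ r • π^* ξ` is a multiple of `r`. -/
theorem Ext_smul_map_eq_smul_of_smul_eq_zero {A B : ModuleCat.{u} R}
    (f : A ⟶ (twistFunctor δ).obj B) (π : A ⟶ B) (hπ : f ≫ (twistFst δ).app B = π) (i : ℕ)
    (r : R) (ξ : ((Ext R (ModuleCat.{u} R) i).obj (.op B)).obj (ModuleCat.of R R))
    (hξ : r • ξ = 0) :
    ∃ η : ((Ext R (ModuleCat.{u} R) i).obj (.op A)).obj (ModuleCat.of R R),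
      δ r • (((Ext R (ModuleCat.{u} R) i).map π.op).app
        (ModuleCat.of R R)).hom ξ = r • η := by
  subst hπ
  let P := projectiveResolution A
  let Q := projectiveResolution B
  obtain ⟨g, hg, hg₀⟩ := ProjectiveResolution.exists_lift_twist f P Q
  let h : P.complex ⟶ Q.complex :=
    { f := fun j => g j ≫ (twistFst δ).app (Q.complex.X j)
      comm' := fun i j _ => by
        rw [← reassoc_of% hg i j, (twistFst δ).naturality, Category.assoc]
        rfl }
  have comm : h.f 0 ≫ Q.π.f 0 = P.π.f 0 ≫ f ≫ (twistFst δ).app B := by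
    exact congrArg (· ≫ (twistFst δ).app B) hg₀
  obtain ⟨η, hη⟩ := HomologicalComplex.smul_homologyMap_eq_smul_of_smul_eq_zero
    (ChainComplex.linearYonedaMap h (ModuleCat.of R R)) (fun j => nablaHom (g j))
    (fun i j φ => by
      refine (nablaHom_comp_map (g j) (Q.complex.d j i) φ).symm.trans ?_
      rw [hg]
      exact nablaHom_comp_left _ _ _)
    r (δ r) (fun j φ => nablaHom_smul (g j) r φ) i
    ((Q.isoExt (R := R) i (ModuleCat.of R R)).hom ξ) (by rw [← map_smul, hξ, map_zero])
  refine ⟨(P.isoExt (R := R) i (ModuleCat.of R R)).inv η, ?_⟩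
  apply (ModuleCat.mono_iff_injective.{u, u} (P.isoExt (R := R) i (ModuleCat.of R R)).hom).1
    inferInstance
  have hn := LinearMap.congr_fun (congrArg ModuleCat.Hom.hom
    (Ext_map_comp_isoExt_hom _ P Q h comm i (ModuleCat.of R R))) ξ
  rw [map_smul, map_smul]
  refine (congrArg (δ r • ·) hn).trans (hη.trans (congrArg (r • ·) ?_))
  simp

end ExtTwist

/-! ### Ideals stable under partial derivatives -/

/-- In characteristic zero, a nonzero ideal of a power series ring over a field that is stable under
the partial derivatives is the whole ring. -/
theorem MvPowerSeries.eq_top_of_forall_pderiv_mem {σ k : Type*} [Field k] [CharZero k]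
    (J : Ideal (MvPowerSeries σ k)) (hJ : ∀ s, ∀ f ∈ J, pderiv k s f ∈ J) (h : J ≠ ⊥) :
    J = ⊤ := by
  classical
  obtain ⟨f, hf, hf0⟩ := Submodule.exists_mem_ne_zero_of_ne_bot h
  obtain ⟨e, he⟩ := (MvPowerSeries.ne_zero_iff_exists_coeff_ne_zero f).1 hf0
  clear hf0
  induction hd : e.degree generalizing e f with
  | zero =>
    rw [Finsupp.degree_eq_zero_iff] at hd
    subst hd
    refine Ideal.eq_top_of_isUnit_mem J hf (MvPowerSeries.isUnit_iff_constantCoeff.2 ?_)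
    simpa using he
  | succ d ih =>
    have he0 : e ≠ 0 := by
      rintro rfl
      simp at hd
    obtain ⟨s, hs⟩ := Finsupp.ne_iff.1 he0
    obtain ⟨e, rfl⟩ := exists_add_of_le (a := Finsupp.single s 1) (b := e)
      (by simpa [Nat.one_le_iff_ne_zero] using hs)
    refine ih (pderiv k s f) (hJ s f hf) e ?_ (by simp at hd; omega)
    rw [coeff_pderiv, add_comm e]
    exact mul_ne_zero he (Nat.cast_add_one_ne_zero _)

/-- In characteristic zero, a nonzero ideal of a polynomial ring over a field that is stable under
the partial derivatives is the whole ring. -/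
theorem MvPolynomial.eq_top_of_forall_pderiv_mem {σ k : Type*} [Field k] [CharZero k]
    (J : Ideal (MvPolynomial σ k)) (hJ : ∀ s, ∀ f ∈ J, pderiv s f ∈ J) (h : J ≠ ⊥) :
    J = ⊤ := by
  classical
  obtain ⟨f, hf, hf0⟩ := Submodule.exists_mem_ne_zero_of_ne_bot h
  -- Units are constants here, unlike for power series: top degree is needed so that differentiating
  -- down to degree zero leaves only a constant.
  obtain ⟨e, he, hmax⟩ := f.support.exists_max_image Finsupp.degree (support_nonempty.2 hf0)
  replace hmax (m : σ →₀ ℕ) (hm : e.degree < m.degree) : coeff m f = 0 :=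
    notMem_support_iff.1 fun h => (hmax m h).not_gt hm
  rw [mem_support_iff] at he
  clear hf0
  induction hd : e.degree generalizing e f with
  | zero =>
    rw [Finsupp.degree_eq_zero_iff] at hd
    subst hd
    have hfC : f = C (coeff 0 f) := by
      ext m
      rw [coeff_C]
      split_ifs with hm
      · rw [hm]
      · exact hmax m (by simpa [pos_iff_ne_zero, Finsupp.degree_eq_zero_iff] using Ne.symm hm)
    rw [hfC] at hf
    exact Ideal.eq_top_of_isUnit_mem J hf (he.isUnit.map C)
  | succ d ih =>
    have he0 : e ≠ 0 := by
      rintro rfl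
      simp at hd
    obtain ⟨s, hs⟩ := Finsupp.ne_iff.1 he0
    obtain ⟨e, rfl⟩ := exists_add_of_le (a := Finsupp.single s 1) (b := e)
      (by simpa [Nat.one_le_iff_ne_zero] using hs)
    refine ih (pderiv s f) (hJ s f hf) e ?_ (fun m hm => ?_) (by simp at hd; omega)
    · rw [coeff_pderiv, add_comm e]
      exact mul_ne_zero he (Nat.cast_add_one_ne_zero _)
    · rw [coeff_pderiv, hmax _ (by simpa [add_comm] using hm), zero_mul]

/-! ### Derivations and local cohomology -/

section LocalCohomology

variable {R : Type u} [CommRing R] (δ : Derivation ℤ R R)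

lemma Derivation.mem_pow_of_mem_pow_succ (I : Ideal R) (t : ℕ) {x : R} (hx : x ∈ I ^ (t + 1)) :
    δ x ∈ I ^ t := by
  induction t generalizing x with
  | zero => simp
  | succ t ih =>
    rw [pow_succ] at hx
    induction hx using Submodule.mul_induction_on' with
    | mem_mul_mem a ha b hb =>
      rw [δ.leibniz, smul_eq_mul, smul_eq_mul]
      refine add_mem (Ideal.mul_mem_right _ _ ha) ?_
      rw [pow_succ, mul_comm b]
      exact Ideal.mul_mem_mul (ih ha) hb
    | add a _ b _ ha hb => rw [map_add]; exact add_mem ha hb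

/-- The map `R ⧸ I ^ (t + 1) → R ⧸ I ^ t × R ⧸ I ^ t` sending the class of `x` to those of
`x` and `δ x`, linear for the twisted module structure. -/
def quotientPowToTwist (I : Ideal R) (t : ℕ) :
    (R ⧸ I ^ (t + 1)) →ₗ[R] TwistedProd δ (R ⧸ I ^ t) :=
  Submodule.liftQ _
    { toFun := fun x => TwistedProd.mk δ (Ideal.Quotient.mk (I ^ t) x)
        (Ideal.Quotient.mk (I ^ t) (δ x))
      map_add' := fun x y => by ext <;> simp
      map_smul' := fun r x => by
        ext
        · rfl
        · simp [Algebra.smul_def, mul_comm] }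
    (fun x hx => TwistedProd.ext
      (Ideal.Quotient.eq_zero_iff_mem.2 (Ideal.pow_le_pow_right t.le_succ hx))
      (Ideal.Quotient.eq_zero_iff_mem.2 (δ.mem_pow_of_mem_pow_succ I t hx)))

/-- The annihilator of a local cohomology module of `R` is stable under all derivations of `R`. -/
theorem derivation_mem_annihilator_localCohomology {S : Type*} [CommRing S] [Algebra S R]
    (d : Derivation S R R) (I : Ideal R) (i : ℕ) {r : R}
    (hr : r ∈ Module.annihilator R ((localCohomology I i).obj (ModuleCat.of R R))) :
    d r ∈ Module.annihilator R ((localCohomology I i).obj (ModuleCat.of R R)) := by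
  let δ : Derivation ℤ R R := d.restrictScalars ℤ
  rw [Module.mem_annihilator] at hr ⊢
  let F := localCohomology.diagram (localCohomology.idealPowersDiagram I) i
  have := localCohomology.hasColimitDiagram (localCohomology.idealPowersDiagram I) i
  let G := F ⋙ (evaluation _ _).obj (ModuleCat.of R R)
  let c : Cocone G := ((evaluation _ _).obj (ModuleCat.of R R)).mapCocone (colimit.cocone F)
  have hc : IsColimit c := isColimitOfPreserves _ (colimit.isColimit F)
  change ∀ m : c.pt, δ r • m = 0
  replace hr : ∀ m : c.pt, r • m = 0 := hr
  intro m
  have : PreservesFilteredColimitsOfSize.{0, 0} (forget (ModuleCat.{u} R)) :=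
    preservesFilteredColimitsOfSize_shrink.{0, u, 0, u} _
  obtain ⟨j, x, rfl⟩ := Concrete.isColimit_exists_rep G hc m
  obtain ⟨j', a, b, hab⟩ := Concrete.isColimit_exists_of_rep_eq G hc (r • x) (0 : G.obj j)
    (by simpa using hr _)
  have hx' : r • G.map a x = 0 := by rw [← map_smul, hab, map_zero]
  have hxx : c.ι.app j x = c.ι.app j' (G.map a x) := by
    rw [← ModuleCat.comp_apply, c.w]
  change δ r • c.ι.app j x = 0
  rw [hxx]
  generalize G.map a x = y at hx'
  obtain ⟨⟨t⟩⟩ := j'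
  -- Since `δ` loses one power of `I`, the relation holds only after passing from `t` to `t + 1`,
  -- which is harmless in the colimit.
  let b : Opposite.op (Opposite.op t) ⟶ Opposite.op (Opposite.op (t + 1)) :=
    (homOfLE t.le_succ).op.op
  have hπ : ModuleCat.ofHom (quotientPowToTwist δ I t) ≫
      (twistFst δ).app (ModuleCat.of R (R ⧸ I ^ t)) =
      (localCohomology.ringModIdeals (localCohomology.idealPowersDiagram I)).map b.unop :=
    ModuleCat.hom_ext (LinearMap.ext fun x => by
      obtain ⟨x, rfl⟩ := Submodule.Quotient.mk_surjective _ x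
      rfl)
  obtain ⟨η, hη⟩ := Ext_smul_map_eq_smul_of_smul_eq_zero (δ := δ)
    (A := ModuleCat.of R (R ⧸ I ^ (t + 1))) (B := ModuleCat.of R (R ⧸ I ^ t))
    _ _ hπ i r y hx'
  have hb : c.ι.app _ y = c.ι.app _ (G.map b y) := by
    rw [← ModuleCat.comp_apply, c.w]
  have hη' : δ r • G.map b y = r • (show G.obj (Opposite.op (Opposite.op (t + 1))) from η) := by
    exact hη
  rw [hb, ← map_smul, hη', map_smul, hr]

end LocalCohomology

theorem annihilator_linearMap_self_eq {R M : Type*} [CommRing R] [AddCommGroup M] [Module R M] :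
    Module.annihilator R (M →ₗ[R] M) = Module.annihilator R M := by
  ext r
  simp only [Module.mem_annihilator]
  exact ⟨fun h m => LinearMap.congr_fun (h LinearMap.id) m, fun h f => LinearMap.ext fun m => h _⟩

theorem theorem4p4 {k : Type*} [Field k] [CharZero k] (n : ℕ) :
    (∀ (I : Ideal (MvPowerSeries (Fin n) k)) (i : ℕ),
      Nontrivial (ringLocalCohomology I i) →
        Module.annihilator (MvPowerSeries (Fin n) k)
          (ringLocalCohomology I i →ₗ[MvPowerSeries (Fin n) k] ringLocalCohomology I i) = ⊥) ∧
    (∀ (I : Ideal (MvPolynomial (Fin n) k)) (i : ℕ),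
      Nontrivial (ringLocalCohomology I i) →
        Module.annihilator (MvPolynomial (Fin n) k)
          (ringLocalCohomology I i →ₗ[MvPolynomial (Fin n) k] ringLocalCohomology I i) = ⊥) := by
  refine ⟨fun I i hM => ?_, fun I i hM => ?_⟩ <;>
    rw [annihilator_linearMap_self_eq] <;>
    by_contra hne
  · have h := MvPowerSeries.eq_top_of_forall_pderiv_mem _ (fun s f hf =>
      derivation_mem_annihilator_localCohomology (MvPowerSeries.pderiv k s) I i hf) hne
    exact not_subsingleton _ (Module.annihilator_eq_top_iff.1 h)
  · have h := MvPolynomial.eq_top_of_forall_pderiv_mem _ (fun s f hf =>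
      derivation_mem_annihilator_localCohomology (MvPolynomial.pderiv s) I i hf) hne
    exact not_subsingleton _ (Module.annihilator_eq_top_iff.1 h)
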